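/- All locally compact groups are Hausdorff. Let $G$ be a locally compact abelian group. A cut-and-project scheme $(G,H,\mathcal L)$ consists of $G$, a locally compact abelian group $H$ and a discrete cocompact subgroup $\mathcal L\subseteq G\times H$ such that the projection $\pi^G\colon\mathcal L\to G$ is injective and the projection of $\mathcal L$ to $H$ is dense in $H$. For $W\subseteq H$ put $\Lambda_W=\pi^G(\mathcal L\cap(G\times W))$. Call $W\subseteq H$ a regular window if $W$ is Borel measurable, $\overline W$ is compact, $W^\circ\neq\varnothing$, and $\partial W=\overline W\setminus W^\circ$ has Haar measure zero. A set $\Gamma\subseteq G$ is called - a regular model set if there are a cut-and-project scheme $(G,H,\mathcal L)$ and a regular window $W\subseteq H$ with $\Gamma=\Lambda_W$; - an inter regular model set if there are a cut-and-project scheme $(G,H,\mathcal L)$ and a regular window $W\subseteq H$ with $\Lambda_{W^\circ}\subseteq\Gamma\subseteq\Lambda_{\overline W}$; - an almost regular model set if there are a cut-and-project scheme $(G,H,\mathcal L)$ and sets $U\subseteq W\subseteq H$ with $U$ non-empty and open, $W$ compact, $W\setminus U$ of Haar measure zero, and $\Lambda_U\subseteq\Gamma\subseteq\Lambda_W$.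 A point set is a set $\Gamma\subseteq G$ such that $\Gamma\cap K$ is finite for every compact $K\subseteq G$. It has finite local complexity if for every compact $K\subseteq G$ the collection $\{(-x+\Gamma)\cap K : x\in\Gamma\}$ is finite. It is repetitive if for every compact $K\subseteq G$ the set $T_K=\{t\in G : (-t+\Gamma)\cap K=\Gamma\cap K\}$ is relatively dense, i.e. $T_K+C=G$ for some compact $C\subseteq G$. Let $\Gamma\subseteq G$ be a repetitive point set of finite local complexity. Then the following are equivalent: (i) $\Gamma$ is a regular model set; (ii) $\Gamma$ is an inter regular model set; (iii) $\Gamma$ is an almost regular model set. -/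

import Mathlib

open scoped Pointwise

universe u v

/-- `(G, H, L)` is a cut-and-project scheme (for locally compact Hausdorff abelian groups `G`, `H`):
`L` is a discrete cocompact subgroup of `G × H` that projects injectively to `G` and densely to
`H`. -/
structure IsCutAndProjectScheme {G : Type u} {H : Type v} [AddCommGroup G] [TopologicalSpace G]
    [AddCommGroup H] [TopologicalSpace H] (L : AddSubgroup (G × H)) : Prop where
  discrete : DiscreteTopology L
  cocompact : CompactSpace ((G × H) ⧸ L)
  injOn_fst : Set.InjOn Prod.fst (L : Set (G × H))
  dense_snd : Dense (Prod.snd '' (L : Set (G × H)))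

/-- The projection set `Λ_W = π^G(L ∩ (G × W))`. -/
def projectionSet {G : Type u} {H : Type v} [AddCommGroup G] [AddCommGroup H]
    (L : AddSubgroup (G × H)) (W : Set H) : Set G :=
  Prod.fst '' ((L : Set (G × H)) ∩ Set.univ ×ˢ W)

/-- Windows of weak model sets: relatively compact and Borel measurable. -/
def IsWeakModelWindow {H : Type v} [TopologicalSpace H] [MeasurableSpace H] (W : Set H) : Prop :=
  IsCompact (closure W) ∧ MeasurableSet W

/-- Windows of model sets: additionally with an interior point. -/
def IsModelWindow {H : Type v} [TopologicalSpace H] [MeasurableSpace H] (W : Set H) : Prop :=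
  IsWeakModelWindow W ∧ (interior W).Nonempty

/-- Windows of regular model sets: additionally the topological boundary has Haar measure zero. -/
def IsRegularModelWindow {H : Type v} [AddCommGroup H] [TopologicalSpace H]
    [IsTopologicalAddGroup H] [LocallyCompactSpace H] [MeasurableSpace H] [BorelSpace H]
    (W : Set H) : Prop :=
  IsModelWindow W ∧ MeasureTheory.Measure.addHaar (frontier W) = 0

/-- `Γ = Λ_W` for a regular window `W` in some cut-and-project scheme `(G, H, L)`. Taking `H` in the
universe of `G` is no restriction, since `H` is Hausdorff and has a dense subset which is the image
of a subset of `G`. -/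
def IsRegularModelSet {G : Type u} [AddCommGroup G] [TopologicalSpace G] (Γ : Set G) : Prop :=
  ∃ (H : Type u) (_ : AddCommGroup H) (_ : TopologicalSpace H) (_ : IsTopologicalAddGroup H)
    (_ : LocallyCompactSpace H) (_ : T2Space H) (_ : MeasurableSpace H) (_ : BorelSpace H)
    (L : AddSubgroup (G × H)) (W : Set H),
    IsCutAndProjectScheme L ∧ IsRegularModelWindow W ∧ Γ = projectionSet L W

/-- `Λ_{int W} ⊆ Γ ⊆ Λ_{cl W}` for a regular window `W` in some cut-and-project scheme. -/
def IsInterRegularModelSet {G : Type u} [AddCommGroup G] [TopologicalSpace G] (Γ : Set G) : Prop :=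
  ∃ (H : Type u) (_ : AddCommGroup H) (_ : TopologicalSpace H) (_ : IsTopologicalAddGroup H)
    (_ : LocallyCompactSpace H) (_ : T2Space H) (_ : MeasurableSpace H) (_ : BorelSpace H)
    (L : AddSubgroup (G × H)) (W : Set H),
    IsCutAndProjectScheme L ∧ IsRegularModelWindow W ∧
      projectionSet L (interior W) ⊆ Γ ∧ Γ ⊆ projectionSet L (closure W)

/-- `Λ_U ⊆ Γ ⊆ Λ_W` in some cut-and-project scheme, where `U ⊆ W`, `U` is non-empty and open, `W` is
compact, and `W \ U` has Haar measure zero. -/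
def IsAlmostRegularModelSet {G : Type u} [AddCommGroup G] [TopologicalSpace G] (Γ : Set G) : Prop :=
  ∃ (H : Type u) (_ : AddCommGroup H) (_ : TopologicalSpace H) (_ : IsTopologicalAddGroup H)
    (_ : LocallyCompactSpace H) (_ : T2Space H) (_ : MeasurableSpace H) (_ : BorelSpace H)
    (L : AddSubgroup (G × H)) (U W : Set H),
    IsCutAndProjectScheme L ∧ U ⊆ W ∧ U.Nonempty ∧ IsOpen U ∧ IsCompact W ∧
      MeasureTheory.Measure.addHaar (W \ U) = 0 ∧
      projectionSet L U ⊆ Γ ∧ Γ ⊆ projectionSet L W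

/-- A point set: a locally finite subset. -/
def IsPointSet {G : Type u} [TopologicalSpace G] (Γ : Set G) : Prop :=
  ∀ K : Set G, IsCompact K → (Γ ∩ K).Finite

/-- Finite local complexity: for each compact `K` there are only finitely many `K`-clusters
`(-x + Γ) ∩ K`, where `x ∈ Γ`. -/
def HasFiniteLocalComplexity {G : Type u} [AddCommGroup G] [TopologicalSpace G] (Γ : Set G) :
    Prop :=
  ∀ K : Set G, IsCompact K → ((fun x : G => (-x +ᵥ Γ) ∩ K) '' Γ).Finite

/-- `T` is relatively dense: `T + C = G` for some compact `C`. -/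
def IsRelativelyDense {G : Type u} [AddCommGroup G] [TopologicalSpace G] (T : Set G) : Prop :=
  ∃ C : Set G, IsCompact C ∧ T + C = Set.univ

/-- Repetitivity: for each compact `K`, the set of all `t` with `(-t + Γ) ∩ K = Γ ∩ K` is relatively
dense. -/
def IsRepetitive {G : Type u} [AddCommGroup G] [TopologicalSpace G] (Γ : Set G) : Prop :=
  ∀ K : Set G, IsCompact K → IsRelativelyDense {t : G | (-t +ᵥ Γ) ∩ K = Γ ∩ K}

/-!
Only the passage from an almost regular to a regular model set needs an argument. Let `U ⊆ W` be
windows with `Λ_U ⊆ Γ ⊆ Λ_W`, and let `Γ*` be the image of `Γ` in `H`. The candidate for the window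
is `V = U ∪ Γ*`: it lies between `U` and `W`, so its boundary is contained in the null set `W \ U`.
There are two obstacles. If `G` is not `σ`-compact, then `Γ*` may be uncountable and `V` need not be
Borel, and if the projection of the lattice to `H` is not injective, then `Λ_V` may exceed `Γ`.

Both disappear after enlarging `H` by a compact group. The abstract group `G` embeds in a direct
sum of copies of a countable divisible subgroup of the circle, since that subgroup is injective and
has elements of every order. In the full product `B` of circles, the image of this embedding
`ψ : G → B` is a countable union of discrete sets: fix the size of the support and a finite set of
values. Replace `H` by the closure of `{(h, ψ g) : (g, h) ∈ L}` in `H × B` and lift the lattice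
accordingly. Then the lattice projects injectively to the new internal space, with `σ`-discrete and
hence Borel, image, so that `Γ*` is Borel as well. The projection to `H` is proper and surjective,
so it pulls compact windows back to compact windows and compact null sets back to null sets.
-/

section SigmaDiscrete

variable {X Y : Type*} [TopologicalSpace X] [TopologicalSpace Y]

/-- A set is `σ`-discrete if it is covered by countably many discrete sets; since subsets of
discrete sets are discrete, it is then also a countable union of discrete sets. -/
def IsSigmaDiscrete (s : Set X) : Prop :=
  ∃ S : Set (Set X), S.Countable ∧ (∀ t ∈ S, IsDiscrete t) ∧ s ⊆ ⋃₀ S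

theorem IsSigmaDiscrete.mono {s t : Set X} (ht : IsSigmaDiscrete t) (hst : s ⊆ t) :
    IsSigmaDiscrete s :=
  let ⟨S, hS, hdisc, htS⟩ := ht
  ⟨S, hS, hdisc, hst.trans htS⟩

theorem isLocallyClosed_of_isDiscrete [T1Space X] {s : Set X} (hs : IsDiscrete s) :
    IsLocallyClosed s := by
  refine ((isLocallyClosed_tfae s).out 0 3).2 fun x hx => ?_
  obtain ⟨U, hU, hUs⟩ := isDiscrete_iff_forall_mem_exists_isOpen.1 hs x hx
  refine ⟨U, (hUs.symm.subset rfl).1, hU, hU.inter_closure.trans ?_⟩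
  rw [hUs, closure_singleton]
  exact Set.singleton_subset_iff.2 hx

theorem IsSigmaDiscrete.measurableSet [T1Space X] [MeasurableSpace X] [OpensMeasurableSpace X]
    {s : Set X} (hs : IsSigmaDiscrete s) : MeasurableSet s := by
  obtain ⟨S, hS, hdisc, hsS⟩ := hs
  rw [← Set.inter_eq_left.2 hsS, Set.sUnion_eq_biUnion, Set.inter_iUnion₂]
  refine .biUnion hS fun t ht => ?_
  obtain ⟨U, Z, hU, hZ, h⟩ :=
    isLocallyClosed_of_isDiscrete ((hdisc t ht).mono Set.inter_subset_right : IsDiscrete (s ∩ t))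
  exact h ▸ hU.measurableSet.inter hZ.measurableSet

theorem isDiscrete_inter_preimage {f : X → Y} (hf : Continuous f) {s : Set X} (hs : s.InjOn f)
    {t : Set Y} (ht : IsDiscrete t) : IsDiscrete (s ∩ f ⁻¹' t) := by
  refine isDiscrete_iff_forall_mem_exists_isOpen.2 fun x ⟨hxs, hxt⟩ => ?_
  obtain ⟨U, hU, hUt⟩ := isDiscrete_iff_forall_mem_exists_isOpen.1 ht (f x) hxt
  refine ⟨f ⁻¹' U, hU.preimage hf, Set.Subset.antisymm ?_ ?_⟩
  · rintro y ⟨hyU, hys, hyt⟩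
    exact hs hys hxs (hUt.subset ⟨hyU, hyt⟩)
  · exact Set.singleton_subset_iff.2 ⟨(hUt.symm.subset rfl).1, hxs, hxt⟩

theorem IsSigmaDiscrete.of_image {f : X → Y} (hf : Continuous f) {s : Set X} (hs : s.InjOn f)
    (h : IsSigmaDiscrete (f '' s)) : IsSigmaDiscrete s := by
  obtain ⟨S, hS, hdisc, hsS⟩ := h
  refine ⟨(fun t => s ∩ f ⁻¹' t) '' S, hS.image _, ?_, fun x hx => ?_⟩
  · rintro _ ⟨t, ht, rfl⟩
    exact isDiscrete_inter_preimage hf hs (hdisc t ht)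
  · obtain ⟨t, ht, hxt⟩ := hsS (Set.mem_image_of_mem f hx)
    exact ⟨_, Set.mem_image_of_mem _ ht, hx, hxt⟩

theorem isDiscrete_ncard_support_eq [Zero X] [T1Space X] (ι : Type*) (n : ℕ) {F : Set X}
    (hF : F.Finite) :
    IsDiscrete {f : ι → X | f.support.Finite ∧ f.support.ncard = n ∧ ∀ i, f i ∈ F} := by
  refine isDiscrete_iff_forall_mem_exists_isOpen.2 fun f ⟨hfin, hcard, hfF⟩ => ?_
  let U : Set (ι → X) := {g | ∀ i ∈ f.support, g i ∉ F \ {f i}}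
  have hU : IsOpen U := by
    have : U = ⋂ i ∈ f.support, (fun g : ι → X => g i) ⁻¹' (F \ {f i})ᶜ := by ext; simp [U]
    rw [this]
    exact hfin.isOpen_biInter fun i _ =>
      hF.sdiff.isClosed.isOpen_compl.preimage (continuous_apply i)
  refine ⟨U, hU, Set.Subset.antisymm ?_ (Set.singleton_subset_iff.2 ⟨fun i _ h => h.2 rfl,
    hfin, hcard, hfF⟩)⟩
  rintro g ⟨hgU, hgfin, hgcard, hgF⟩
  have hgf : ∀ i ∈ f.support, g i = f i := fun i hi =>
    by_contra fun h => hgU i hi ⟨hgF i, h⟩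
  have hsub : f.support ⊆ g.support := fun i hi => by
    rwa [Function.mem_support, hgf i hi]
  have hsupp : f.support = g.support :=
    Set.eq_of_subset_of_ncard_le hsub (hgcard.trans hcard.symm).le hgfin
  refine funext fun i => ?_
  by_cases hi : i ∈ f.support
  · exact hgf i hi
  · exact (Function.notMem_support.1 (hsupp ▸ hi)).trans (Function.notMem_support.1 hi).symm

theorem isSigmaDiscrete_finite_support [Zero X] [T1Space X] (ι : Type*) {A : Set X}
    (hA : A.Countable) :
    IsSigmaDiscrete {f : ι → X | f.support.Finite ∧ ∀ i, f i ∈ A} := by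
  let piece (p : ℕ × Set X) : Set (ι → X) :=
    {f | f.support.Finite ∧ f.support.ncard = p.1 ∧ ∀ i, f i ∈ p.2}
  refine ⟨piece '' (Set.univ ×ˢ {F | F.Finite ∧ F ⊆ A}),
    (Set.countable_univ.prod (Set.countable_ofPred_finite_subset hA)).image _, ?_, ?_⟩
  · rintro _ ⟨⟨n, F⟩, ⟨-, hF, -⟩, rfl⟩
    exact isDiscrete_ncard_support_eq ι n hF
  · rintro f ⟨hfin, hfA⟩
    have hrange : (Set.range f).Finite :=
      (hfin.image f |>.insert 0).subset (Function.range_subset_insert_image_support f)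
    exact ⟨_, Set.mem_image_of_mem piece (x := (f.support.ncard, Set.range f))
      ⟨trivial, hrange, Set.range_subset_iff.2 hfA⟩, hfin, rfl, Set.mem_range_self⟩

end SigmaDiscrete

section IndependentSets

variable {α : Type*} [CompleteLattice α]

theorem sSupIndep_insert [IsModularLattice α] {s : Set α} (hs : sSupIndep s) {a : α}
    (ha : Disjoint a (sSup s)) : sSupIndep (insert a s) := by
  rintro x hx
  obtain rfl | hxa := eq_or_ne x a
  · exact ha.mono_right (sSup_le_sSup (by simp))
  · have hxs : x ∈ s := hx.resolve_left hxa
    rw [Set.insert_sdiff_of_notMem _ (by simpa using hxa.symm), sSup_insert, sup_comm]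
    refine (hs hxs).disjoint_sup_right_of_disjoint_sup_left (ha.symm.mono_left ?_)
    exact sup_le (le_sSup hxs) (sSup_le_sSup Set.sdiff_subset)

theorem exists_subset_sSupIndep_forall_disjoint_eq_bot [IsModularLattice α]
    [IsCompactlyGenerated α] (P : Set α) :
    ∃ s ⊆ P, sSupIndep s ∧ ∀ a ∈ P, Disjoint a (sSup s) → a = ⊥ := by
  obtain ⟨s, hs⟩ := zorn_subset {s : Set α | s ⊆ P ∧ sSupIndep s} fun c hc hchain =>
    ⟨⋃₀ c, ⟨Set.sUnion_subset fun t ht => (hc ht).1,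
      iSupIndep_sUnion_of_directed hchain.directedOn fun t ht => (hc ht).2⟩,
      fun _ => Set.subset_sUnion_of_mem⟩
  refine ⟨s, hs.prop.1, hs.prop.2, fun a haP ha => ?_⟩
  have has : a ∈ s := hs.le_of_ge
    ⟨Set.insert_subset haP hs.prop.1, sSupIndep_insert hs.prop.2 ha⟩ (Set.subset_insert a s)
    (Set.mem_insert a s)
  exact disjoint_self.1 (ha.mono_right (le_sSup has))

end IndependentSets

section EssentialExtension

variable {R : Type*} [Ring R] {M : Type u} [AddCommGroup M] [Module R M]
  {Q : Type v} [AddCommGroup Q] [Module R Q]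

theorem exists_injective_of_baer {N S : Type*} [AddCommGroup N] [Module R N]
    [AddCommGroup S] [Module R S] (hN : Module.Baer R N) (i : S →ₗ[R] M)
    (hi : Function.Injective i)
    (hess : ∀ p : Submodule R M, Disjoint p i.range → p = ⊥)
    (g : S →ₗ[R] N) (hg : Function.Injective g) :
    ∃ f : M →ₗ[R] N, Function.Injective f := by
  obtain ⟨f, rfl⟩ := hN.extension_property i hi g
  refine ⟨f, LinearMap.ker_eq_bot.1 (hess _ (Submodule.disjoint_def.2 ?_))⟩
  rintro _ hf ⟨x, rfl⟩
  rw [hg ((LinearMap.mem_ker.1 hf).trans (map_zero (f ∘ₗ i)).symm), map_zero]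

theorem exists_injective_span_singleton_of_torsionOf_eq {x : M} {a : Q}
    (h : Ideal.torsionOf R Q a = Ideal.torsionOf R M x) :
    ∃ f : Submodule.span R {x} →ₗ[R] Q, Function.Injective f :=
  let e := (Ideal.quotTorsionOfEquivSpanSingleton R M x).symm ≪≫ₗ
    Submodule.quotEquivOfEq _ _ h.symm ≪≫ₗ Ideal.quotTorsionOfEquivSpanSingleton R Q a
  ⟨(Submodule.span R {a}).subtype ∘ₗ e.toLinearMap, Subtype.val_injective.comp e.injective⟩

theorem exists_injective_finsupp_of_forall_torsionOf_eq
    (hQ : ∀ ι : Type u, Module.Baer R (ι →₀ Q))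
    (h : ∀ x : M, ∃ a : Q, Ideal.torsionOf R Q a = Ideal.torsionOf R M x) :
    ∃ (ι : Type u) (f : M →ₗ[R] (ι →₀ Q)), Function.Injective f := by
  classical
  obtain ⟨s, hsP, hs, hmax⟩ := exists_subset_sSupIndep_forall_disjoint_eq_bot
    {p : Submodule R M | ∃ g : p →ₗ[R] Q, Function.Injective g}
  choose g hg using fun p : s => hsP p.2
  let sum : (Π₀ p : s, (p : Submodule R M)) →ₗ[R] M :=
    DFinsupp.lsum ℕ fun p => (p : Submodule R M).subtype
  have hsum : sum.range = sSup s := by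
    rw [sSup_eq_iSup', Submodule.iSup_eq_range_dfinsupp_lsum]
  refine ⟨s, exists_injective_of_baer (hQ s) sum
    ((sSupIndep_iff s).1 hs).dfinsupp_lsum_injective (fun p hp => ?_)
    ((finsuppLequivDFinsupp R).symm.toLinearMap ∘ₗ DFinsupp.mapRange.linearMap g)
    ((finsuppLequivDFinsupp R).symm.injective.comp
      ((DFinsupp.mapRange_injective _ fun p => map_zero (g p)).2 hg))⟩
  refine (Submodule.eq_bot_iff p).2 fun x hx => Submodule.span_singleton_eq_bot.1 (hmax _ ?_ ?_)
  · exact (h x).elim fun a ha => exists_injective_span_singleton_of_torsionOf_eq ha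
  · exact hsum ▸ hp.mono_left ((Submodule.span_singleton_le_iff_mem x p).2 hx)

end EssentialExtension

section Circle

theorem baer_finsupp_of_divisibleBy (ι A : Type*) [AddCommGroup A] [DivisibleBy A ℤ] :
    Module.Baer ℤ (ι →₀ A) :=
  have : DivisibleBy (ι →₀ A) ℤ := divisibleByOfSMulRightSurj _ _ fun {n} hn f => by
    obtain ⟨g, rfl⟩ := Finsupp.mapRange_surjective (fun a : A => n • a) (smul_zero n)
      (DivisibleBy.surjective_smul A _ hn) f
    exact ⟨g, by ext; simp⟩
  .of_divisible _

/-- The points of the circle `ℝ / ℤ` represented by real algebraic numbers. They form a countable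
divisible group which, like the circle, has elements of every order. -/
noncomputable def algebraicCircle : AddSubgroup UnitAddCircle :=
  (algebraicClosure ℚ ℝ).toSubalgebra.toSubring.toAddSubgroup.map (QuotientAddGroup.mk' _)

theorem countable_algebraicCircle : (algebraicCircle : Set UnitAddCircle).Countable :=
  ((Algebraic.countable ℚ ℝ).mono fun _ => mem_algebraicClosure_iff.1).image _

theorem coe_mem_algebraicCircle {x : ℝ} (hx : IsAlgebraic ℚ x) :
    (x : UnitAddCircle) ∈ algebraicCircle :=
  ⟨x, mem_algebraicClosure_iff.2 hx, rfl⟩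

noncomputable instance algebraicCircle.divisibleBy : DivisibleBy algebraicCircle ℤ :=
  divisibleByOfSMulRightSurj _ _ fun {n} hn => by
    rintro ⟨_, x, hx, rfl⟩
    have hxn : IsAlgebraic ℚ ((n : ℝ)⁻¹ * x) :=
      (isAlgebraic_intCast n).inv.mul (mem_algebraicClosure_iff.1 hx)
    refine ⟨⟨_, coe_mem_algebraicCircle hxn⟩, Subtype.ext ?_⟩
    have : (n : ℝ) ≠ 0 := Int.cast_ne_zero.2 hn
    simp [← AddCircle.coe_zsmul, this]

theorem exists_mem_algebraicCircle_addOrderOf_eq (n : ℕ) :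
    ∃ a ∈ algebraicCircle, addOrderOf a = n := by
  obtain rfl | hn := n.eq_zero_or_pos
  · have halg : IsAlgebraic ℚ √2 := .of_pow two_pos (by simpa using isAlgebraic_natCast 2)
    refine ⟨_, coe_mem_algebraicCircle halg, addOrderOf_eq_zero ?_⟩
    refine AddCircle.not_isOfFinAddOrder_iff_forall_rat_ne_div.2 fun q hq => ?_
    exact irrational_sqrt_two ⟨q, hq.trans (div_one _)⟩
  · exact ⟨_, coe_mem_algebraicCircle (by simpa using (isAlgebraic_natCast n).inv),
      AddCircle.addOrderOf_period_div hn⟩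

theorem torsionOf_int_eq_of_addOrderOf_eq {D E : Type*} [AddCommGroup D] [AddCommGroup E]
    {x : D} {y : E}
    (h : addOrderOf x = addOrderOf y) : Ideal.torsionOf ℤ D x = Ideal.torsionOf ℤ E y := by
  ext n
  rw [Ideal.mem_torsionOf_iff, Ideal.mem_torsionOf_iff, ← addOrderOf_dvd_iff_zsmul_eq_zero, h,
    addOrderOf_dvd_iff_zsmul_eq_zero]

theorem exists_injective_finsupp_algebraicCircle (D : Type u) [AddCommGroup D] :
    ∃ (ι : Type u) (f : D →ₗ[ℤ] (ι →₀ algebraicCircle)), Function.Injective f :=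
  exists_injective_finsupp_of_forall_torsionOf_eq
    (fun ι => baer_finsupp_of_divisibleBy ι algebraicCircle) fun x =>
    let ⟨a, ha, hax⟩ := exists_mem_algebraicCircle_addOrderOf_eq (addOrderOf x)
    ⟨⟨a, ha⟩, torsionOf_int_eq_of_addOrderOf_eq ((AddSubgroup.addOrderOf_mk a ha).trans hax)⟩

theorem exists_injective_pi_unitAddCircle_isSigmaDiscrete_range (D : Type u) [AddCommGroup D] :
    ∃ (ι : Type u) (ψ : D →+ (ι → UnitAddCircle)),
      Function.Injective ψ ∧ IsSigmaDiscrete (Set.range ψ) := by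
  obtain ⟨ι, f, hf⟩ := exists_injective_finsupp_algebraicCircle D
  let ψ : D →+ (ι → UnitAddCircle) :=
    .mk' (fun d i => f d i) fun d e => funext fun i => by simp
  refine ⟨ι, ψ, fun d e h => hf (Finsupp.ext fun i => Subtype.ext (congrFun h i)),
    (isSigmaDiscrete_finite_support ι countable_algebraicCircle).mono ?_⟩
  rintro _ ⟨d, rfl⟩
  refine ⟨(f d).hasFiniteSupport.subset fun i hi => ?_, fun i => (f d i).2⟩
  exact fun h => hi (congrArg Subtype.val h)

end Circle

section QuotientMaps

variable {X Y : Type*} [AddCommGroup X] [AddCommGroup Y] (f : X →+ Y) (L : AddSubgroup X)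

theorem preimage_mk_image_quotientAddGroup_map (C : Set (X ⧸ L)) :
    ((↑) : Y → Y ⧸ L.map f) ⁻¹' (QuotientAddGroup.map L (L.map f) f (L.le_comap_map f) '' C) =
      f '' (((↑) : X → X ⧸ L) ⁻¹' C) := by
  ext y
  constructor
  · rintro ⟨q, hq, hqy⟩
    obtain ⟨x, rfl⟩ := QuotientAddGroup.mk_surjective q
    obtain ⟨l, hl, hly⟩ := QuotientAddGroup.eq.1 hqy
    refine ⟨x + l, ?_, by rw [map_add, hly, add_neg_cancel_left]⟩
    rwa [Set.mem_preimage, QuotientAddGroup.mk_add_of_mem x hl]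
  · rintro ⟨x, hx, rfl⟩
    exact ⟨x, hx, rfl⟩

theorem preimage_quotientAddGroup_map_singleton_mk (y : Y) :
    QuotientAddGroup.map L (L.map f) f (L.le_comap_map f) ⁻¹' {(y : Y ⧸ L.map f)} =
      ((↑) : X → X ⧸ L) '' (f ⁻¹' {y}) := by
  ext q
  constructor
  · intro hq
    obtain ⟨x, hx, hxy⟩ := (preimage_mk_image_quotientAddGroup_map f L {q}).subset ⟨q, rfl, hq⟩
    exact ⟨x, hxy, hx⟩
  · rintro ⟨x, rfl, rfl⟩
    rfl

variable {f} [TopologicalSpace X] [TopologicalSpace Y]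

theorem isProperMap_quotientAddGroup_map (hf : IsProperMap f) :
    IsProperMap (QuotientAddGroup.map L (L.map f) f (L.le_comap_map f)) := by
  refine isProperMap_iff_isClosedMap_and_compact_fibers.2 ⟨?_, fun C hC => ?_, fun q => ?_⟩
  · exact (QuotientAddGroup.continuous_mk.comp hf.continuous).quotient_lift _
  · refine isQuotientMap_quotient_mk'.isClosed_preimage.1 ?_
    refine (preimage_mk_image_quotientAddGroup_map f L C).symm ▸ ?_
    exact hf.isClosedMap _ (hC.preimage QuotientAddGroup.continuous_mk)
  · obtain ⟨y, rfl⟩ := QuotientAddGroup.mk_surjective q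
    rw [preimage_quotientAddGroup_map_singleton_mk]
    exact (hf.isCompact_preimage isCompact_singleton).image QuotientAddGroup.continuous_mk

theorem compactSpace_quotient_of_isProperMap (hf : IsProperMap f) [CompactSpace (Y ⧸ L.map f)] :
    CompactSpace (X ⧸ L) :=
  ⟨(isProperMap_quotientAddGroup_map L hf).isCompact_preimage isCompact_univ⟩

end QuotientMaps

section Windows

variable {H K : Type*} [AddCommGroup H] [TopologicalSpace H] [IsTopologicalAddGroup H]
  [LocallyCompactSpace H] [MeasurableSpace H] [BorelSpace H]
  [AddCommGroup K] [TopologicalSpace K] [IsTopologicalAddGroup K] [LocallyCompactSpace K]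
  [MeasurableSpace K] [BorelSpace K]

theorem addHaar_preimage_eq_zero {p : K →+ H} (hp : IsProperMap p)
    (hsurj : Function.Surjective p) {A : Set H} (hA : IsCompact (closure A))
    (h0 : MeasureTheory.Measure.addHaar A = 0) : MeasureTheory.Measure.addHaar (p ⁻¹' A) = 0 := by
  let μ := (MeasureTheory.Measure.addHaar : MeasureTheory.Measure K).map p
  have : μ.IsAddHaarMeasure :=
    MeasureTheory.Measure.isAddHaarMeasure_map _ p hp.continuous hsurj <|
      Filter.hasBasis_cocompact.tendsto_right_iff.2 fun _ hC =>
        (hp.isCompact_preimage hC).compl_mem_cocompact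
  have hμA : μ A = 0 := by
    rw [MeasureTheory.Measure.measure_isAddInvariant_eq_smul_of_isCompact_closure μ
      MeasureTheory.Measure.addHaar hA, h0, smul_zero]
  exact le_zero_iff.1
    ((MeasureTheory.Measure.le_map_apply hp.continuous.aemeasurable A).trans_eq hμA)

/-- The pairs `U ⊆ W` of a non-empty open set and a compact set with Haar null difference, which
define almost regular model sets. -/
structure IsAlmostRegularWindow (U W : Set H) : Prop where
  subset : U ⊆ W
  nonempty : U.Nonempty
  isOpen : IsOpen U
  isCompact : IsCompact W
  addHaar_sdiff : MeasureTheory.Measure.addHaar (W \ U) = 0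

theorem IsAlmostRegularWindow.preimage {U W : Set H} (h : IsAlmostRegularWindow U W)
    {p : K →+ H} (hp : IsProperMap p) (hsurj : Function.Surjective p) :
    IsAlmostRegularWindow (p ⁻¹' U) (p ⁻¹' W) where
  subset := Set.preimage_mono h.subset
  nonempty := h.nonempty.preimage hsurj
  isOpen := h.isOpen.preimage hp.continuous
  isCompact := hp.isCompact_preimage h.isCompact
  addHaar_sdiff := addHaar_preimage_eq_zero hp hsurj (h.isCompact.diff h.isOpen).closure
    h.addHaar_sdiff

theorem IsAlmostRegularWindow.isRegularModelWindow [T2Space H] {U V W : Set H}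
    (h : IsAlmostRegularWindow U W) (hUV : U ⊆ V) (hVW : V ⊆ W) (hV : MeasurableSet V) :
    IsRegularModelWindow V := by
  have hU : U ⊆ interior V := interior_maximal hUV h.isOpen
  have hW : closure V ⊆ W := closure_minimal hVW h.isCompact.isClosed
  exact ⟨⟨⟨h.isCompact.of_isClosed_subset isClosed_closure hW, hV⟩, h.nonempty.mono hU⟩,
    MeasureTheory.measure_mono_null (Set.sdiff_subset_sdiff hW hU) h.addHaar_sdiff⟩

end Windows

section StarImage

variable {G : Type u} {H : Type v} [AddCommGroup G] [AddCommGroup H]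

theorem projectionSet_mono (L : AddSubgroup (G × H)) {V W : Set H} (h : V ⊆ W) :
    projectionSet L V ⊆ projectionSet L W :=
  Set.image_mono (Set.inter_subset_inter_right _ (Set.prod_mono_right h))

theorem projectionSet_union (L : AddSubgroup (G × H)) (V W : Set H) :
    projectionSet L (V ∪ W) = projectionSet L V ∪ projectionSet L W := by
  rw [projectionSet, Set.prod_union, Set.inter_union_distrib_left, Set.image_union]
  rfl

theorem projectionSet_preimage {K : Type*} [AddCommGroup K] (L : AddSubgroup (G × K))
    (p : K →+ H) (W : Set H) :
    projectionSet L (p ⁻¹' W) = projectionSet (L.map ((AddMonoidHom.id G).prodMap p)) W := by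
  ext g
  constructor
  · rintro ⟨⟨g, k⟩, ⟨hL, -, hk⟩, rfl⟩
    exact ⟨(g, p k), ⟨⟨(g, k), hL, rfl⟩, trivial, hk⟩, rfl⟩
  · rintro ⟨_, ⟨⟨⟨g, k⟩, hL, rfl⟩, -, hk⟩, rfl⟩
    exact ⟨(g, k), ⟨hL, trivial, hk⟩, rfl⟩

/-- The image `Γ* = π^H(L ∩ (Γ × H))` of `Γ` in the internal space, the smallest candidate for a
window of `Γ`. -/
def starImage (L : AddSubgroup (G × H)) (Γ : Set G) : Set H :=
  Prod.snd '' ((L : Set (G × H)) ∩ Γ ×ˢ Set.univ)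

theorem starImage_subset {L : AddSubgroup (G × H)} (hL : Set.InjOn Prod.fst (L : Set (G × H)))
    {Γ : Set G} {W : Set H} (hΓ : Γ ⊆ projectionSet L W) : starImage L Γ ⊆ W := by
  rintro _ ⟨⟨g, h⟩, ⟨hgh, hg, -⟩, rfl⟩
  obtain ⟨y, ⟨hy, -, hyW⟩, hyg⟩ := hΓ hg
  exact hL hy hgh hyg ▸ hyW

theorem projectionSet_starImage {L : AddSubgroup (G × H)}
    (hL : Set.InjOn Prod.snd (L : Set (G × H))) {Γ : Set G} {W : Set H}
    (hΓ : Γ ⊆ projectionSet L W) : projectionSet L (starImage L Γ) = Γ := by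
  refine Set.Subset.antisymm ?_ fun g hg => ?_
  · rintro _ ⟨x, ⟨hx, -, y, ⟨hy, hyΓ, -⟩, hyx⟩, rfl⟩
    exact hL hy hx hyx ▸ hyΓ
  · obtain ⟨x, ⟨hx, -, -⟩, rfl⟩ := hΓ hg
    exact ⟨x, ⟨hx, trivial, x, ⟨hx, hg, trivial⟩, rfl⟩, rfl⟩

end StarImage

theorem IsAlmostRegularWindow.isRegularModelSet {G H : Type u} [AddCommGroup G]
    [TopologicalSpace G] [AddCommGroup H] [TopologicalSpace H] [IsTopologicalAddGroup H]
    [LocallyCompactSpace H] [T2Space H] [MeasurableSpace H] [BorelSpace H]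
    {L : AddSubgroup (G × H)} {U W : Set H} (hW : IsAlmostRegularWindow U W)
    (hL : IsCutAndProjectScheme L) (hinj : Set.InjOn Prod.snd (L : Set (G × H)))
    (hdisc : IsSigmaDiscrete (Prod.snd '' (L : Set (G × H)))) {Γ : Set G}
    (hUΓ : projectionSet L U ⊆ Γ) (hΓW : Γ ⊆ projectionSet L W) : IsRegularModelSet Γ := by
  have hstar : MeasurableSet (starImage L Γ) :=
    (hdisc.mono (Set.image_mono Set.inter_subset_left)).measurableSet
  refine ⟨H, _, _, ‹_›, ‹_›, ‹_›, _, ‹_›, L, U ∪ starImage L Γ, hL,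
    hW.isRegularModelWindow Set.subset_union_left
      (Set.union_subset hW.subset (starImage_subset hL.injOn_fst hΓW))
      (hW.isOpen.measurableSet.union hstar), ?_⟩
  rw [projectionSet_union, projectionSet_starImage hinj hΓW, Set.union_eq_right.2 hUΓ]

section Extension

variable {G : Type u} {H : Type v} {B : Type*} [AddCommGroup G] [AddCommGroup H]
  [TopologicalSpace H] [IsTopologicalAddGroup H] [AddCommGroup B] [TopologicalSpace B]
  [IsTopologicalAddGroup B]

/-- The internal space of the extension of a cut-and-project scheme `(G, H, L)` along a
homomorphism `ψ : G → B`: the closure of `{(h, ψ g) : (g, h) ∈ L}` in `H × B`. -/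
def extendedInternalSpace (L : AddSubgroup (G × H)) (ψ : G →+ B) : AddSubgroup (H × B) :=
  (L.map ((AddMonoidHom.snd G H).prod (ψ.comp (AddMonoidHom.fst G H)))).topologicalClosure

/-- The projection of the extended internal space to the original one. -/
def extendedInternalSpaceFst (L : AddSubgroup (G × H)) (ψ : G →+ B) :
    extendedInternalSpace L ψ →+ H :=
  (AddMonoidHom.fst H B).comp (extendedInternalSpace L ψ).subtype

/-- The projection of the extended internal space to the group `B` along which it is extended. -/
def extendedInternalSpaceSnd (L : AddSubgroup (G × H)) (ψ : G →+ B) :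
    extendedInternalSpace L ψ →+ B :=
  (AddMonoidHom.snd H B).comp (extendedInternalSpace L ψ).subtype

/-- The lattice of the extension of `(G, H, L)` along `ψ`, consisting of all `(g, (h, ψ g))` with
`(g, h) ∈ L`. -/
def extendedLattice (L : AddSubgroup (G × H)) (ψ : G →+ B) :
    AddSubgroup (G × extendedInternalSpace L ψ) :=
  L.comap ((AddMonoidHom.id G).prodMap (extendedInternalSpaceFst L ψ)) ⊓
    ((extendedInternalSpaceSnd L ψ).comp (AddMonoidHom.snd G _)).eqLocus
      (ψ.comp (AddMonoidHom.fst G _))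

variable {L : AddSubgroup (G × H)} (ψ : G →+ B)

theorem isClosedEmbedding_extendedInternalSpace_subtypeVal (L : AddSubgroup (G × H)) :
    Topology.IsClosedEmbedding (Subtype.val : extendedInternalSpace L ψ → H × B) :=
  (AddSubgroup.isClosed_topologicalClosure _).isClosedEmbedding_subtypeVal

theorem mk_mem_extendedInternalSpace {g : G} {h : H} (hgh : (g, h) ∈ L) :
    (h, ψ g) ∈ extendedInternalSpace L ψ :=
  subset_closure ⟨(g, h), hgh, rfl⟩

theorem mk_mem_extendedLattice {g : G} {h : H} (hgh : (g, h) ∈ L) :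
    (g, ⟨(h, ψ g), mk_mem_extendedInternalSpace ψ hgh⟩) ∈ extendedLattice L ψ :=
  ⟨hgh, rfl⟩

theorem map_extendedLattice (L : AddSubgroup (G × H)) :
    (extendedLattice L ψ).map ((AddMonoidHom.id G).prodMap (extendedInternalSpaceFst L ψ)) = L :=
  le_antisymm (AddSubgroup.map_le_iff_le_comap.2 inf_le_left) fun _ hgh =>
    ⟨_, mk_mem_extendedLattice ψ hgh, rfl⟩

theorem injOn_extendedLattice (L : AddSubgroup (G × H)) :
    Set.InjOn ((AddMonoidHom.id G).prodMap (extendedInternalSpaceFst L ψ))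
      (extendedLattice L ψ : Set (G × extendedInternalSpace L ψ)) := by
  intro x hx y hy hxy
  obtain ⟨hG, hH⟩ : x.1 = y.1 ∧ x.2.1.1 = y.2.1.1 := Prod.mk.inj hxy
  have hB : x.2.1.2 = y.2.1.2 := hx.2.trans ((congrArg ψ hG).trans hy.2.symm)
  exact Prod.ext hG (Subtype.ext (Prod.ext hH hB))

theorem injOn_snd_extendedLattice (hψ : Function.Injective ψ) :
    Set.InjOn Prod.snd (extendedLattice L ψ : Set (G × extendedInternalSpace L ψ)) := by
  intro x hx y hy hxy
  have hB : ψ x.1 = ψ y.1 :=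
    hx.2.symm.trans ((congrArg (extendedInternalSpaceSnd L ψ) hxy).trans hy.2)
  exact Prod.ext (hψ hB) hxy

theorem isSigmaDiscrete_snd_image_extendedLattice (hL : Set.InjOn Prod.fst (L : Set (G × H)))
    (hψ : Function.Injective ψ) (hdisc : IsSigmaDiscrete (Set.range ψ)) :
    IsSigmaDiscrete
      (Prod.snd '' (extendedLattice L ψ : Set (G × extendedInternalSpace L ψ))) := by
  have hcont : Continuous (extendedInternalSpaceSnd L ψ) :=
    continuous_snd.comp continuous_subtype_val
  refine .of_image hcont ?_ (hdisc.mono ?_)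
  · rintro _ ⟨x, hx, rfl⟩ _ ⟨y, hy, rfl⟩ hB
    have hG : x.1 = y.1 := hψ (hx.2.symm.trans (hB.trans hy.2))
    exact congrArg Prod.snd (injOn_extendedLattice ψ L hx hy (hL hx.1 hy.1 hG))
  · rintro _ ⟨_, ⟨x, hx, rfl⟩, rfl⟩
    exact ⟨x.1, hx.2.symm⟩

theorem isProperMap_extendedInternalSpaceFst [CompactSpace B] (L : AddSubgroup (G × H)) :
    IsProperMap (extendedInternalSpaceFst L ψ) :=
  isProperMap_fst_of_compactSpace.comp
    (isClosedEmbedding_extendedInternalSpace_subtypeVal ψ L).isProperMap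

theorem dense_snd_image_extendedLattice (L : AddSubgroup (G × H)) :
    Dense (Prod.snd '' (extendedLattice L ψ : Set (G × extendedInternalSpace L ψ))) := by
  refine Subtype.dense_iff.2 fun x hx => closure_mono ?_ hx
  rintro _ ⟨⟨g, h⟩, hgh, rfl⟩
  exact ⟨_, ⟨_, mk_mem_extendedLattice ψ hgh, rfl⟩, rfl⟩

theorem surjective_extendedInternalSpaceFst [CompactSpace B]
    (hL : Dense (Prod.snd '' (L : Set (G × H)))) :
    Function.Surjective (extendedInternalSpaceFst L ψ) := by
  refine Set.range_eq_univ.1 ?_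
  rw [← (isProperMap_extendedInternalSpaceFst ψ L).isClosedMap.isClosed_range.closure_eq]
  refine (hL.mono ?_).closure_eq
  rintro _ ⟨⟨g, h⟩, hgh, rfl⟩
  exact ⟨⟨(h, ψ g), mk_mem_extendedInternalSpace ψ hgh⟩, rfl⟩

theorem IsCutAndProjectScheme.extendedLattice [TopologicalSpace G] [CompactSpace B]
    (hL : IsCutAndProjectScheme L) : IsCutAndProjectScheme (extendedLattice L ψ) where
  discrete := by
    have hcont : Continuous ((AddMonoidHom.id G).prodMap (extendedInternalSpaceFst L ψ)) :=
      continuous_id.prodMap (isProperMap_extendedInternalSpaceFst ψ L).continuous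
    refine SetLike.isDiscrete_iff_discreteTopology.1 ?_
    exact (isDiscrete_inter_preimage hcont (injOn_extendedLattice ψ L) ⟨hL.discrete⟩).mono
      (Set.subset_inter subset_rfl fun _ hx => hx.1)
  cocompact := by
    have := hL.cocompact
    rw [← map_extendedLattice ψ L] at this
    exact compactSpace_quotient_of_isProperMap
      (f := (AddMonoidHom.id G).prodMap (extendedInternalSpaceFst L ψ)) _
      (isProperMap_id.prodMap (isProperMap_extendedInternalSpaceFst ψ L))
  injOn_fst _ hx _ hy hxy := injOn_extendedLattice ψ L hx hy (hL.injOn_fst hx.1 hy.1 hxy)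
  dense_snd := dense_snd_image_extendedLattice ψ L

end Extension

section ModelSets

variable {G : Type u} [AddCommGroup G] [TopologicalSpace G] {Γ : Set G}

theorem IsRegularModelSet.isInterRegularModelSet (h : IsRegularModelSet Γ) :
    IsInterRegularModelSet Γ := by
  obtain ⟨H, _, _, _, _, _, _, _, L, W, hL, hW, rfl⟩ := h
  exact ⟨H, _, _, ‹_›, ‹_›, ‹_›, _, ‹_›, L, W, hL, hW, projectionSet_mono L interior_subset,
    projectionSet_mono L subset_closure⟩

theorem IsInterRegularModelSet.isAlmostRegularModelSet (h : IsInterRegularModelSet Γ) :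
    IsAlmostRegularModelSet Γ := by
  obtain ⟨H, _, _, _, _, _, _, _, L, W, hL, ⟨⟨⟨hcl, -⟩, hint⟩, hnull⟩, hΓ⟩ := h
  exact ⟨H, _, _, ‹_›, ‹_›, ‹_›, _, ‹_›, L, interior W, closure W, hL,
    interior_subset.trans subset_closure, hint, isOpen_interior, hcl, hnull, hΓ⟩

theorem IsAlmostRegularModelSet.isRegularModelSet (h : IsAlmostRegularModelSet Γ) :
    IsRegularModelSet Γ := by
  obtain ⟨H, _, _, _, _, _, _, _, L, U, W, hL, hUW, hUne, hU, hW, hnull, hUΓ, hΓW⟩ := h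
  obtain ⟨ι, ψ, hψ, hdisc⟩ := exists_injective_pi_unitAddCircle_isSigmaDiscrete_range G
  have : LocallyCompactSpace (extendedInternalSpace L ψ) :=
    (isClosedEmbedding_extendedInternalSpace_subtypeVal ψ L).locallyCompactSpace
  borelize ↥(extendedInternalSpace L ψ)
  have hpreimage (V : Set H) : projectionSet (extendedLattice L ψ)
      (extendedInternalSpaceFst L ψ ⁻¹' V) = projectionSet L V := by
    rw [projectionSet_preimage, map_extendedLattice]
  have hwindow : IsAlmostRegularWindow (extendedInternalSpaceFst L ψ ⁻¹' U)
      (extendedInternalSpaceFst L ψ ⁻¹' W) :=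
    IsAlmostRegularWindow.preimage ⟨hUW, hUne, hU, hW, hnull⟩
      (isProperMap_extendedInternalSpaceFst ψ L)
      (surjective_extendedInternalSpaceFst ψ hL.dense_snd)
  exact hwindow.isRegularModelSet (hL.extendedLattice ψ) (injOn_snd_extendedLattice ψ hψ)
    (isSigmaDiscrete_snd_image_extendedLattice ψ hL.injOn_fst hψ hdisc)
    ((hpreimage U).trans_subset hUΓ) (hΓW.trans_eq (hpreimage W).symm)

end ModelSets

theorem mainTheorem6_general {G : Type u} [AddCommGroup G] [TopologicalSpace G] (Γ : Set G) :
    List.TFAE [IsRegularModelSet Γ, IsInterRegularModelSet Γ, IsAlmostRegularModelSet Γ] := by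
  tfae_have 1 → 2 := IsRegularModelSet.isInterRegularModelSet
  tfae_have 2 → 3 := IsInterRegularModelSet.isAlmostRegularModelSet
  tfae_have 3 → 1 := IsAlmostRegularModelSet.isRegularModelSet
  tfae_finish

theorem mainTheorem6 {G : Type u} [AddCommGroup G] [TopologicalSpace G] [IsTopologicalAddGroup G]
    [LocallyCompactSpace G] [T2Space G] (Γ : Set G) (hpt : IsPointSet Γ)
    (hflc : HasFiniteLocalComplexity Γ) (hrep : IsRepetitive Γ) :
    List.TFAE [IsRegularModelSet Γ, IsInterRegularModelSet Γ, IsAlmostRegularModelSet Γ] :=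
  mainTheorem6_general Γ
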